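/- Let $f(x)=a_nx^n+\dots+a_1x+a_0$ be a polynomial with real coefficients, of degree $n\ge 1$ (so $a_n\ne 0$), with $a_0>0$, and let $\alpha_1,\dots,\alpha_n\in\mathbb{C}$ be its roots. Put $a_j=0$ for $j<0$ and for $j>n$. For $1\le k\le n$ and each of the two signs $\pm$, let $\widetilde D_k^{\pm}(f)(x)\in\mathbb{R}[x]$ be the determinant of the $k\times k$ matrix whose entry in row $i$ and column $j$ $(1\le i,j\le k)$ is $$a_{j-i}\,x^{j-i}\;\pm\;a_{i+j+n-k-1}\,x^{i+j+n-k-1},$$ where a term with a zero coefficient $a_m$ ($m<0$ or $m>n$) is read as $0$. Let $s>0$ be real. Then each of the following four conditions is equivalent to the property that $|\alpha_i|>s$ for all $i=1,\dots,n$: 1. $\widetilde D_k^{\pm}(f)(s)>0$ for all $1\le k\le n$ and both signs; 2. $f(s)>0$, $f(-s)>0$, and $\widetilde D_k^{\pm}(f)(s)>0$ for all $1\le k\le n-1$ and both signs; 3. $\widetilde D_k^{\pm}(f)(s)>0$ for both signs and all $k\ge 1$ among $n,\,n-2,\,n-4,\dots$; 4. $f(s)>0$, $f(-s)>0$, and $\widetilde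 D_k^{\pm}(f)(s)>0$ for both signs and all $k\ge 1$ among $n-1,\,n-3,\,n-5,\dots$. -/

import Mathlib

open Polynomial

/-- The coefficient of `f` at an integer index, with value `0` at negative indices
(`Polynomial.coeff` already vanishes above the degree). -/
noncomputable def intCoeff {R : Type*} [CommRing R] (f : R[X]) (m : ℤ) : R :=
  if 0 ≤ m then f.coeff m.toNat else 0

/-- The `k × k` determinant with entries `a (j - i) ± a (i + j + n - k - 1)` for `1 ≤ i, j ≤ k`,
built from a sequence `a` indexed by the integers; the sign is `ε`. The rows and columns of
the matrix are indexed from `0` in `Fin k`, hence the shifts by `1`. -/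
def specialDet {R : Type*} [CommRing R] (a : ℤ → R) (n k : ℕ) (ε : ℤˣ) : R :=
  Matrix.det (Matrix.of fun i j : Fin k =>
    a (((j : ℤ) + 1) - ((i : ℤ) + 1)) +
      ((ε : ℤ) : R) * a (((i : ℤ) + 1) + ((j : ℤ) + 1) + (n : ℤ) - (k : ℤ) - 1))

/-- The `D`-polynomial of `f`, with `n = deg f`: the determinant above formed from the
terms `a_j x ^ j` of `f` in place of its coefficients `a_j`
(where `a_j = 0` for `j < 0`, so the exponent `Int.toNat j` only matters for `0 ≤ j`). -/
noncomputable def DPoly {R : Type*} [CommRing R] (f : R[X]) (k : ℕ) (ε : ℤˣ) : R[X] :=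
  specialDet (fun m : ℤ => C (intCoeff f m) * X ^ m.toNat) f.natDegree k ε

/-!
Replacing `f` by `f (s x)` turns the terms `a_j s ^ j` into coefficients, so one may take `s = 1`:
the property to be characterised is that `f` has no zero in the closed unit disc.

The proof is an induction on a formal degree `n` (any bound for the degree), carried by the Schur
transform `g = a₀ f - aₙ f*`, where `f* = xⁿ f(1/x)`; it has formal degree `n - 1`. Let `M` be the
`k × k` matrix whose determinant is `D_k^ε(f)` and `J` the matrix reversing the order of the basis.
Then `M (a₀ - ε aₙ J)` has the matrix of `D_{k-1}^ε(g)` as its upper left block, and its last row is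
`(0, …, 0, a₀² - aₙ²)`. Hence `D_k^ε(f) · det (a₀ - ε aₙ J) = D_{k-1}^ε(g) · (a₀² - aₙ²)`
(`specialDet_schur`). If `|aₙ| < a₀`, the two extra factors are positive, so `D_k^ε(f)` and
`D_{k-1}^ε(g)` are positive together (`specialDet_schurTransform_pos_iff`).

On the other side, the maximum modulus principle gives `|f*| ≤ |f|` on the disc whenever `f` has no
zero there (`norm_aeval_reflect_le`). Since `(a₀² - aₙ²) f = a₀ g + aₙ g*`, it follows for
`|aₙ| < a₀` that `f` is zero-free on the disc if and only if `g` is.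

It remains to see that each condition forces `|aₙ| < a₀`. If `f` is zero-free, this is Vieta's
formula. Otherwise it follows from `D_1^± = a₀ ± aₙ`, or from
`D_2^+ + D_2^- = 2 (a₀² - aₙ²)`, and whichever of `k = 1, 2` has the required parity is available;
in formal degree `1` the values `f(±1) = a₀ ± a₁` serve instead of `D_1^±`. The parity of `n - k`
is unchanged when `(n, k)` becomes `(n - 1, k - 1)`, and `g(±1)` is a positive multiple of `f(±1)`,
so the two conditions on every other determinant are inherited by `g`. The two conditions on all
determinants contain them.
-/

/-! ### The determinants and their behaviour under the Schur transform -/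

theorem specialDet_one {R : Type*} [CommRing R] (a : ℤ → R) (n : ℕ) (ε : ℤˣ) :
    specialDet a n 1 ε = a 0 + ((ε : ℤ) : R) * a n := by
  have h : (2 : ℤ) + n - 1 - 1 = n := by ring
  simp [specialDet, h]

/-- The part which is even in `ε` is `a 0 ^ 2 - a (n + 2) ^ 2`; this is what bounds the last
coefficient when the determinant of order `1` is not at hand. -/
theorem specialDet_two {R : Type*} [CommRing R] (a : ℤ → R) (n : ℕ) (ε : ℤˣ)
    (ha : ∀ m : ℤ, m < 0 → a m = 0) (ha' : ∀ m : ℤ, (n : ℤ) + 2 < m → a m = 0) :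
    specialDet a (n + 2) 2 ε = a 0 ^ 2 - a (n + 2) ^ 2 +
      ((ε : ℤ) : R) * (a 0 * a (n + 1) - a (n + 2) * a 1) := by
  have e : ((ε : ℤ) : R) * ((ε : ℤ) : R) = 1 := by
    rcases Int.units_eq_one_or ε with rfl | rfl <;> simp
  have h00 : (n : ℤ) + 2 - 1 = n + 1 := by ring
  have h01 : (3 : ℤ) + (n + 2) - 2 - 1 = n + 2 := by ring
  have h11 : (4 : ℤ) + (n + 2) - 2 - 1 = n + 3 := by ring
  have h1 : a (-1) = 0 := ha _ (by norm_num)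
  have h2 : a ((n : ℤ) + 3) = 0 := ha' _ (by linarith)
  simp only [specialDet, Matrix.det_fin_two, Matrix.of_apply, Fin.val_zero, Fin.val_one]
  norm_num
  rw [h00, h01, h11, h1, h2]
  linear_combination (- a (n + 2) ^ 2) * e

/-- The matrix `p - c J`, with `J` the order-reversing permutation matrix, has positive determinant
for `|c| < p`: it is the square of the invertible matrix `u + v J`, where `u + v` and `u - v` are
the square roots of `p - c` and `p + c`. -/
theorem det_sub_smul_rev_pos (k : ℕ) {p c : ℝ} (h : |c| < p) :
    0 < (Matrix.of fun i j : Fin k =>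
      (if i = j then p else 0) - c * (if i = j.rev then 1 else 0)).det := by
  obtain ⟨h1, h2⟩ := abs_lt.mp h
  obtain ⟨J, hJ⟩ : ∃ J : Matrix (Fin k) (Fin k) ℝ,
    J = Matrix.of fun i j => if i = j.rev then 1 else 0 := ⟨_, rfl⟩
  have hJJ : J * J = 1 := by
    ext i j
    simp [hJ, Matrix.mul_apply, Matrix.one_apply]
  have hM : (Matrix.of fun i j : Fin k =>
      (if i = j then p else 0) - c * (if i = j.rev then 1 else 0)) = p • 1 - c • J := by
    ext i j
    simp [hJ, Matrix.one_apply]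
  have s1 : √(p - c) ^ 2 = p - c := Real.sq_sqrt (by linarith)
  have s2 : √(p + c) ^ 2 = p + c := Real.sq_sqrt (by linarith)
  obtain ⟨u, hu⟩ : ∃ u, u = (√(p - c) + √(p + c)) / 2 := ⟨_, rfl⟩
  obtain ⟨v, hv⟩ : ∃ v, v = (√(p - c) - √(p + c)) / 2 := ⟨_, rfl⟩
  have huv : u ^ 2 + v ^ 2 = p := by rw [hu, hv]; linear_combination (s1 + s2) / 2
  have huv' : 2 * (u * v) = - c := by rw [hu, hv]; linear_combination (s1 - s2) / 2
  have hne : u ^ 2 - v ^ 2 ≠ 0 := by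
    have : u ^ 2 - v ^ 2 = √(p - c) * √(p + c) := by rw [hu, hv]; ring
    rw [this]
    exact (mul_pos (Real.sqrt_pos.2 (by linarith)) (Real.sqrt_pos.2 (by linarith))).ne'
  have hsq : (u • 1 + v • J) * (u • 1 + v • J) = p • 1 - c • J := by
    simp only [add_mul, mul_add, smul_mul_smul_comm, hJJ, one_mul, mul_one]
    rw [← huv, ← neg_eq_iff_eq_neg.mpr huv']
    module
  have hunit : (u • 1 + v • J) * (u • 1 - v • J) = (u ^ 2 - v ^ 2) • 1 := by
    simp only [add_mul, mul_sub, smul_mul_smul_comm, hJJ, one_mul, mul_one]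
    module
  have hdet : (u • 1 + v • J).det ≠ 0 := by
    intro h0
    have := congrArg Matrix.det hunit
    rw [Matrix.det_mul, h0, zero_mul, Matrix.det_smul, Matrix.det_one, mul_one] at this
    exact pow_ne_zero _ hne this.symm
  rw [hM, ← hsq, Matrix.det_mul]
  exact mul_self_pos.mpr hdet

/-- The reduction of the order: multiplying the matrix of the determinant of order `k + 1` on the
right by `a 0 - ε a (n + 1) J`, with `J` the order-reversing permutation matrix, gives a matrix whose
last row vanishes off the diagonal and whose upper left block is the matrix of the determinant of
order `k` for the transformed sequence. -/
theorem specialDet_schur {R : Type*} [CommRing R] (a : ℤ → R) (n k : ℕ) (ε : ℤˣ)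
    (ha : ∀ m : ℤ, m < 0 → a m = 0) (ha' : ∀ m : ℤ, (n : ℤ) + 1 < m → a m = 0) (hk : 1 ≤ k) :
    specialDet a (n + 1) (k + 1) ε *
      (Matrix.of fun i j : Fin (k + 1) =>
        (if i = j then a 0 else 0) -
          ((ε : ℤ) : R) * a (n + 1) * (if i = j.rev then 1 else 0)).det =
    specialDet (fun m => a 0 * a m - a (n + 1) * a (n + 1 - m)) n k ε *
      (a 0 ^ 2 - a (n + 1) ^ 2) := by
  have e : ((ε : ℤ) : R) * ((ε : ℤ) : R) = 1 := by
    rcases Int.units_eq_one_or ε with rfl | rfl <;> simp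
  obtain ⟨M, hM⟩ : ∃ M : Matrix (Fin (k + 1)) (Fin (k + 1)) R,
    M = Matrix.of fun i j : Fin (k + 1) =>
    a (((j : ℤ) + 1) - ((i : ℤ) + 1)) + ((ε : ℤ) : R) *
      a (((i : ℤ) + 1) + ((j : ℤ) + 1) + ((n + 1 : ℕ) : ℤ) - ((k + 1 : ℕ) : ℤ) - 1) := ⟨_, rfl⟩
  -- Multiplication by `J` on the right reverses the order of the columns.
  have hN : ∀ i j, (M * Matrix.of fun i j : Fin (k + 1) =>
        (if i = j then a 0 else 0) -
          ((ε : ℤ) : R) * a (n + 1) * (if i = j.rev then 1 else 0)) i j =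
      a 0 * M i j - ((ε : ℤ) : R) * a (n + 1) * M i j.rev := by
    intro i j
    simp [Matrix.mul_apply, mul_sub, Finset.sum_sub_distrib]
    ring
  -- The last row of `M` is `(ε a (n + 1), 0, …, 0, a 0)`, because `a` is supported in `[0, n + 1]`.
  have hlast : ∀ j : Fin (k + 1), M (Fin.last k) j =
      (if j = Fin.last k then a 0 else 0) +
        (if j.rev = Fin.last k then ((ε : ℤ) : R) * a (n + 1) else 0) := by
    intro j
    rw [hM, Matrix.of_apply]
    congr 1
    · split_ifs with h
      · subst h; simp
      · apply ha
        have := j.isLt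
        have : (j : ℕ) ≠ k := fun h' => h (Fin.ext h')
        simp only [Fin.val_last]; omega
    · split_ifs with h
      · have : (j : ℕ) = 0 := by
          have := congrArg Fin.val h
          simp only [Fin.val_rev, Fin.val_last] at this
          have := j.isLt
          omega
        congr 2
        rw [this]; simp only [Fin.val_last]; push_cast; ring
      · have : (j : ℕ) ≠ 0 := by
          intro h'
          apply h; ext; simp [Fin.val_rev, h']
        rw [ha', mul_zero]
        simp only [Fin.val_last]; push_cast; omega
  unfold specialDet
  rw [← hM, ← Matrix.det_mul, Matrix.det_succ_row _ (Fin.last k), Finset.sum_eq_single (Fin.last k)]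
  · rw [hN, hlast, hlast, mul_comm]
    -- This is where `1 ≤ k` is needed: the first and last columns differ.
    have h0 : ¬ (Fin.rev (Fin.last k) = Fin.last k) := by
      intro h
      have := congrArg Fin.val h
      simp at this
      omega
    simp only [Fin.rev_rev, h0, if_true, if_false]
    congr 1
    · congr 1
      ext i j
      rw [Matrix.submatrix_apply, hN, hM]
      simp only [Matrix.of_apply, Fin.succAbove_last, Fin.val_castSucc, Fin.val_rev]
      have e1 : ((k + 1 - ((j : ℕ) + 1) : ℕ) : ℤ) = k - j := by
        have := j.isLt
        omega
      rw [e1]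
      push_cast
      -- Reversing the columns interchanges the Toeplitz and the Hankel part of the matrix.
      have q1 : ((k : ℤ) - j + 1 - (i + 1)) = n + 1 - (i + 1 + (j + 1) + n - k - 1) := by ring
      have q2 : ((i : ℤ) + 1 + (k - j + 1) + (n + 1) - (k + 1) - 1) =
        n + 1 - (j + 1 - (i + 1)) := by ring
      have q3 : ((i : ℤ) + 1 + (j + 1) + (n + 1) - (k + 1) - 1) = i + 1 + (j + 1) + n - k - 1 := by
        ring
      rw [q1, q2, q3]
      linear_combination (- a (n + 1) * a (n + 1 - (j + 1 - (i + 1)))) * e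
    · simp only [Fin.val_last, Even.neg_one_pow (Even.add_self k)]
      linear_combination (- a (n + 1) ^ 2) * e
  · intro j _ hj
    rw [hN, hlast, hlast]
    simp only [Fin.rev_rev, hj, if_false]
    split_ifs <;> ring
  · simp


/-- The Schur transform `a₀ f - aₙ f*`, where `f* = xⁿ f(1/x)` and `n` is a formal degree of `f`:
a bound for the degree, which need not be attained. -/
noncomputable def schurTransform (f : ℝ[X]) (n : ℕ) : ℝ[X] :=
  C (f.coeff 0) * f - C (f.coeff n) * f.reflect n

theorem coeff_schurTransform_zero (f : ℝ[X]) (n : ℕ) :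
    (schurTransform f n).coeff 0 = f.coeff 0 ^ 2 - f.coeff n ^ 2 := by
  simp [schurTransform, coeff_reflect]
  ring

theorem natDegree_schurTransform_le {f : ℝ[X]} {n : ℕ} (hf : f.natDegree ≤ n + 1) :
    (schurTransform f (n + 1)).natDegree ≤ n := by
  rw [natDegree_le_iff_coeff_eq_zero]
  intro m hm
  rw [schurTransform, coeff_sub, coeff_C_mul, coeff_C_mul, coeff_reflect]
  rcases eq_or_lt_of_le (Nat.succ_le_of_lt hm) with h | h
  -- The coefficient of degree `n + 1` is `a₀ aₙ₊₁ - aₙ₊₁ a₀`.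
  · have : m = n + 1 := h.symm
    subst this
    rw [revAt_le le_rfl, Nat.sub_self]
    ring
  · rw [revAt_eq_self_of_lt h, coeff_eq_zero_of_natDegree_lt (lt_of_le_of_lt hf h)]
    ring

theorem intCoeff_of_neg (f : ℝ[X]) {m : ℤ} (hm : m < 0) : intCoeff f m = 0 :=
  if_neg (not_le.mpr hm)

theorem intCoeff_natCast (f : ℝ[X]) (m : ℕ) : intCoeff f m = f.coeff m := by
  simp [intCoeff]

theorem intCoeff_of_lt {f : ℝ[X]} {n : ℕ} (hf : f.natDegree ≤ n) {m : ℤ} (hm : (n : ℤ) < m) :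
    intCoeff f m = 0 := by
  lift m to ℕ using by omega
  rw [intCoeff_natCast]
  exact coeff_eq_zero_of_natDegree_lt (by omega)

theorem intCoeff_schurTransform {f : ℝ[X]} {n : ℕ} (hf : f.natDegree ≤ n) (m : ℤ) :
    intCoeff (schurTransform f n) m =
      intCoeff f 0 * intCoeff f m - intCoeff f n * intCoeff f (n - m) := by
  rcases lt_or_ge m 0 with hm | hm
  · rw [intCoeff_of_neg _ hm, intCoeff_of_neg _ hm, intCoeff_of_lt hf (by omega : (n : ℤ) < n - m)]
    ring
  lift m to ℕ using hm
  have h0 : intCoeff f 0 = f.coeff 0 := intCoeff_natCast f 0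
  rw [h0, intCoeff_natCast, intCoeff_natCast, intCoeff_natCast, schurTransform, coeff_sub,
    coeff_C_mul, coeff_C_mul, coeff_reflect]
  rcases le_or_gt m n with h | h
  · rw [revAt_le h, ← Nat.cast_sub h, intCoeff_natCast]
  · rw [revAt_eq_self_of_lt h, coeff_eq_zero_of_natDegree_lt (lt_of_le_of_lt hf h),
      intCoeff_of_neg _ (by omega)]

theorem sq_sub_sq_pos_iff {a b : ℝ} (ha : 0 < a) : 0 < a ^ 2 - b ^ 2 ↔ |b| < a := by
  rw [sub_pos, sq_lt_sq, abs_of_pos ha]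

/-- The step of the induction for the determinants. -/
theorem specialDet_schurTransform_pos_iff {f : ℝ[X]} {n k : ℕ} (hf : f.natDegree ≤ n + 1)
    (h : |f.coeff (n + 1)| < f.coeff 0) (hk : 1 ≤ k) (ε : ℤˣ) :
    0 < specialDet (intCoeff (schurTransform f (n + 1))) n k ε ↔
      0 < specialDet (intCoeff f) (n + 1) (k + 1) ε := by
  have key := specialDet_schur (intCoeff f) n k ε (fun m hm => intCoeff_of_neg f hm)
    (fun m hm => intCoeff_of_lt hf (by exact_mod_cast hm)) hk
  have h0 : intCoeff f 0 = f.coeff 0 := intCoeff_natCast f 0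
  have h1 : intCoeff f ((n : ℤ) + 1) = f.coeff (n + 1) := intCoeff_natCast f (n + 1)
  have hg : (fun m => intCoeff f 0 * intCoeff f m -
      intCoeff f ((n : ℤ) + 1) * intCoeff f ((n : ℤ) + 1 - m)) =
      intCoeff (schurTransform f (n + 1)) := by
    funext m
    rw [intCoeff_schurTransform hf]
    push_cast
    rfl
  rw [hg, h0, h1] at key
  have hc : |((ε : ℤ) : ℝ) * f.coeff (n + 1)| < f.coeff 0 := by
    rcases Int.units_eq_one_or ε with rfl | rfl <;> simpa using h
  have hpos := det_sub_smul_rev_pos (k + 1) hc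
  have hδ := (sq_sub_sq_pos_iff ((abs_nonneg _).trans_lt h)).mpr h
  rw [← mul_pos_iff_of_pos_right hδ, ← key, mul_pos_iff_of_pos_right hpos]

theorem specialDet_one_pos_iff {f : ℝ[X]} {n : ℕ} :
    (∀ ε, 0 < specialDet (intCoeff f) n 1 ε) ↔ |f.coeff n| < f.coeff 0 := by
  have h0 : intCoeff f 0 = f.coeff 0 := intCoeff_natCast f 0
  simp only [specialDet_one, h0, intCoeff_natCast, abs_lt]
  constructor
  · intro h
    have h1 := h 1
    have h2 := h (-1)
    simp at h1 h2
    constructor <;> linarith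
  · rintro ⟨h1, h2⟩ ε
    rcases Int.units_eq_one_or ε with rfl | rfl <;> simp <;> linarith

theorem abs_coeff_lt_of_specialDet_two_pos {f : ℝ[X]} {n : ℕ} (hf : f.natDegree ≤ n + 2)
    (h0 : 0 < f.coeff 0) (h : ∀ ε, 0 < specialDet (intCoeff f) (n + 2) 2 ε) :
    |f.coeff (n + 2)| < f.coeff 0 := by
  rw [← sq_sub_sq_pos_iff h0]
  have key := fun ε => specialDet_two (intCoeff f) n ε (fun m hm => intCoeff_of_neg f hm)
    (fun m hm => intCoeff_of_lt hf (by exact_mod_cast hm))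
  have e0 : intCoeff f 0 = f.coeff 0 := intCoeff_natCast f 0
  have e1 : intCoeff f ((n : ℤ) + 2) = f.coeff (n + 2) := intCoeff_natCast f (n + 2)
  have h1 := h 1
  have h2 := h (-1)
  rw [key, e0, e1] at h1 h2
  simp at h1 h2
  linarith

/-! ### Zeros in the closed unit disc -/

/-- The quotient `f* / f` is holomorphic on the disc, and of modulus `1` on the circle because
`f*(w) = wⁿ f(w̄)` there; so the maximum modulus principle bounds it by `1`. -/
theorem norm_aeval_reflect_le {f : ℝ[X]} {n : ℕ} (hf : f.natDegree ≤ n)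
    (h : ∀ z : ℂ, ‖z‖ ≤ 1 → aeval z f ≠ 0) {z : ℂ} (hz : ‖z‖ ≤ 1) :
    ‖aeval z (f.reflect n)‖ ≤ ‖aeval z f‖ := by
  have hcl : closure (Metric.ball (0 : ℂ) 1) = Metric.closedBall 0 1 :=
    closure_ball _ one_ne_zero
  have hd : DiffContOnCl ℂ (fun w : ℂ => aeval w (f.reflect n) / aeval w f) (Metric.ball 0 1) := by
    apply DifferentiableOn.diffContOnCl
    rw [hcl]
    exact (Polynomial.differentiable_aeval _).differentiableOn.div
      (Polynomial.differentiable_aeval _).differentiableOn fun w hw => h w (by simpa using hw)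
  have hle : ∀ w ∈ frontier (Metric.ball (0 : ℂ) 1),
      ‖aeval w (f.reflect n) / aeval w f‖ ≤ 1 := by
    intro w hw
    rw [frontier_ball _ one_ne_zero, mem_sphere_zero_iff_norm] at hw
    have hw0 : w ≠ 0 := by rintro rfl; simp at hw
    have hinv : w⁻¹ = (starRingEnd ℂ) w := Complex.inv_eq_conj hw
    let : Invertible w⁻¹ := invertibleOfNonzero (inv_ne_zero hw0)
    have key := eval₂_reflect_mul_pow (algebraMap ℝ ℂ) w⁻¹ n f hf
    rw [invOf_eq_inv, inv_inv, hinv, ← aeval_def, ← aeval_def, aeval_conj] at key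
    have := congrArg norm key
    rw [norm_mul, norm_pow, RCLike.norm_conj, RCLike.norm_conj, hw, one_pow, mul_one] at this
    rw [norm_div, this]
    exact div_self_le_one _
  have := Complex.norm_le_of_forall_mem_frontier_norm_le Metric.isBounded_ball hd hle
    (z := z) (by rw [hcl]; simpa using hz)
  rwa [norm_div, div_le_one (norm_pos_iff.mpr (h z hz))] at this

theorem one_lt_norm_multiset_prod {m : Multiset ℂ} (h : ∀ z ∈ m, 1 < ‖z‖) (hm : m ≠ 0) :
    1 < ‖m.prod‖ := by
  induction m using Multiset.induction with
  | empty => exact absurd rfl hm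
  | cons a t ih =>
    rw [Multiset.prod_cons, norm_mul]
    have ha := h a (Multiset.mem_cons_self a t)
    rcases eq_or_ne t 0 with rfl | ht
    · simpa using ha
    · have := ih (fun z hz => h z (Multiset.mem_cons_of_mem hz)) ht
      nlinarith

/-- If `aₙ ≠ 0`, then by Vieta's formula `|a₀ / aₙ|` is the product of the moduli of the roots. -/
theorem abs_coeff_lt_of_aeval_ne_zero {f : ℝ[X]} {n : ℕ} (hn : n ≠ 0) (hf : f.natDegree ≤ n)
    (h0 : 0 < f.coeff 0) (h : ∀ z : ℂ, ‖z‖ ≤ 1 → aeval z f ≠ 0) : |f.coeff n| < f.coeff 0 := by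
  rcases hf.lt_or_eq with hlt | rfl
  · simpa [coeff_eq_zero_of_natDegree_lt hlt] using h0
  have hs : (f.map (algebraMap ℝ ℂ)).Splits := IsAlgClosed.splits _
  have hf0 : f ≠ 0 := by rintro rfl; simp at h0
  have hr : ∀ z ∈ (f.map (algebraMap ℝ ℂ)).roots, 1 < ‖z‖ := by
    intro z hz
    by_contra! hle
    exact h z hle ((mem_aroots.mp hz).2)
  have hne : (f.map (algebraMap ℝ ℂ)).roots ≠ 0 := by
    intro he
    have := hs.natDegree_eq_card_roots
    rw [he] at this
    simp at this
    exact hn this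
  have key := congrArg norm hs.coeff_zero_eq_leadingCoeff_mul_prod_roots
  simp only [coeff_map, leadingCoeff_map, norm_mul, norm_pow, norm_neg, norm_one, one_pow,
    one_mul, Complex.coe_algebraMap, Complex.norm_real, Real.norm_eq_abs] at key
  rw [abs_of_pos h0] at key
  rw [key]
  have hpos : 0 < |f.leadingCoeff| := abs_pos.mpr (leadingCoeff_ne_zero.mpr hf0)
  exact lt_mul_of_one_lt_right hpos (one_lt_norm_multiset_prod hr hne)

/-- The form of Rouché's argument used to compare the zeros of `f` with those of its transform. -/
theorem mul_add_mul_ne_zero {a b : ℝ} (hab : |b| < a) {p q : ℂ} (hp : p ≠ 0) (hq : ‖q‖ ≤ ‖p‖) :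
    (a : ℂ) * p + b * q ≠ 0 := by
  intro h
  have h1 := congrArg norm (eq_neg_of_add_eq_zero_left h)
  rw [norm_neg, norm_mul, norm_mul, Complex.norm_real, Complex.norm_real, Real.norm_eq_abs,
    Real.norm_eq_abs, abs_of_pos ((abs_nonneg b).trans_lt hab)] at h1
  have h2 : |b| * ‖q‖ ≤ |b| * ‖p‖ := mul_le_mul_of_nonneg_left hq (abs_nonneg b)
  have h3 : |b| * ‖p‖ < a * ‖p‖ := mul_lt_mul_of_pos_right hab (norm_pos_iff.mpr hp)
  linarith

theorem aeval_schurTransform_ne_zero {f : ℝ[X]} {n : ℕ} (hf : f.natDegree ≤ n)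
    (hlt : |f.coeff n| < f.coeff 0) (h : ∀ z : ℂ, ‖z‖ ≤ 1 → aeval z f ≠ 0) {z : ℂ}
    (hz : ‖z‖ ≤ 1) : aeval z (schurTransform f n) ≠ 0 := by
  have := mul_add_mul_ne_zero (b := - f.coeff n) (by rwa [abs_neg]) (h z hz)
    (norm_aeval_reflect_le hf h hz)
  simpa [schurTransform, sub_eq_add_neg] using this

theorem aeval_ne_zero_of_schurTransform {f : ℝ[X]} {n : ℕ} (hf : f.natDegree ≤ n + 1)
    (hlt : |f.coeff (n + 1)| < f.coeff 0)
    (h : ∀ z : ℂ, ‖z‖ ≤ 1 → aeval z (schurTransform f (n + 1)) ≠ 0) {z : ℂ}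
    (hz : ‖z‖ ≤ 1) : aeval z f ≠ 0 := by
  have h1 := mul_add_mul_ne_zero hlt (h z hz) (norm_aeval_reflect_le
    ((natDegree_schurTransform_le hf).trans n.le_succ) h hz)
  -- The reflection of `g = a₀ f - a f*`, with `a = aₙ₊₁`, is `g* = a₀ f* - a f`, so that
  -- `a₀ g + a g* = (a₀² - a²) f`.
  have hrr : (f.reflect (n + 1)).reflect (n + 1) = f := by
    ext m
    simp
  intro h0
  apply h1
  simp only [schurTransform, reflect_sub, reflect_C_mul, hrr, map_sub, map_mul, aeval_C, h0,
    Complex.coe_algebraMap]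
  ring

/-! ### The criteria on the unit disc -/

theorem specialDet_pos_of_aeval_ne_zero (n : ℕ) : ∀ f : ℝ[X], f.natDegree ≤ n → 0 < f.coeff 0 →
    (∀ z : ℂ, ‖z‖ ≤ 1 → aeval z f ≠ 0) → ∀ k, 1 ≤ k → k ≤ n → ∀ ε,
      0 < specialDet (intCoeff f) n k ε := by
  induction n with
  | zero => intro f _ _ _ k h1 h2; omega
  | succ n ih =>
    intro f hf h0 h k h1 h2 ε
    have hlt := abs_coeff_lt_of_aeval_ne_zero n.succ_ne_zero hf h0 h
    rcases h1.eq_or_lt with rfl | h1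
    · exact specialDet_one_pos_iff.mpr hlt ε
    obtain ⟨k, rfl⟩ : ∃ l, k = l + 1 := ⟨k - 1, by omega⟩
    rw [← specialDet_schurTransform_pos_iff hf hlt (by omega)]
    refine ih _ (natDegree_schurTransform_le hf) ?_
      (fun z hz => aeval_schurTransform_ne_zero hf hlt h hz) k (by omega) (by omega) ε
    rw [coeff_schurTransform_zero]
    exact (sq_sub_sq_pos_iff h0).mpr hlt

theorem aeval_ne_zero_of_natDegree_le_zero {f : ℝ[X]} (hf : f.natDegree ≤ 0)
    (h0 : 0 < f.coeff 0) (z : ℂ) : aeval z f ≠ 0 := by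
  rw [eq_C_of_natDegree_le_zero hf]
  simpa using h0.ne'

/-- Half of the determinants suffice: those with `n - k` even. -/
theorem aeval_ne_zero_of_specialDet_pos (n : ℕ) : ∀ f : ℝ[X], f.natDegree ≤ n → 0 < f.coeff 0 →
    (∀ k, 1 ≤ k → k ≤ n → Even (n - k) → ∀ ε, 0 < specialDet (intCoeff f) n k ε) →
    ∀ z : ℂ, ‖z‖ ≤ 1 → aeval z f ≠ 0 := by
  induction n with
  | zero => intro f hf h0 _ z _; exact aeval_ne_zero_of_natDegree_le_zero hf h0 z
  | succ n ih =>
    intro f hf h0 h z hz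
    have hlt : |f.coeff (n + 1)| < f.coeff 0 := by
      rcases Nat.even_or_odd n with he | ⟨m, rfl⟩
      · exact specialDet_one_pos_iff.mp (h 1 le_rfl (by omega) (by simpa using he))
      · exact abs_coeff_lt_of_specialDet_two_pos hf h0
          (h 2 (by omega) (by omega) ⟨m, by omega⟩)
    refine aeval_ne_zero_of_schurTransform hf hlt
      (ih _ (natDegree_schurTransform_le hf) ?_ ?_) hz
    · rw [coeff_schurTransform_zero]
      exact (sq_sub_sq_pos_iff h0).mpr hlt
    · intro k h1 h2 he ε
      rw [specialDet_schurTransform_pos_iff hf hlt h1]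
      exact h _ (by omega) (by omega) (by rwa [Nat.add_sub_add_right]) ε

theorem eval_one_reflect {f : ℝ[X]} {n : ℕ} (hf : f.natDegree ≤ n) :
    (f.reflect n).eval 1 = f.eval 1 := by
  let : Invertible (1 : ℝ) := invertibleOne
  have := eval₂_reflect_mul_pow (RingHom.id ℝ) 1 n f hf
  rw [invOf_one, one_pow, mul_one] at this
  exact this

theorem eval_neg_one_reflect {f : ℝ[X]} {n : ℕ} (hf : f.natDegree ≤ n) :
    (f.reflect n).eval (-1) = (-1) ^ n * f.eval (-1) := by
  let : Invertible (-1 : ℝ) := invertibleOfNonzero (by norm_num)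
  have := eval₂_reflect_mul_pow (RingHom.id ℝ) (-1) n f hf
  rw [invOf_eq_inv, inv_neg, inv_one] at this
  change (f.reflect n).eval (-1) * _ = f.eval (-1) at this
  rw [← this, mul_comm, mul_assoc, ← mul_pow]
  simp

/-- The other half of the determinants suffices together with the values at `±1`. -/
theorem aeval_ne_zero_of_eval_pos_of_specialDet_pos (n : ℕ) : ∀ f : ℝ[X], f.natDegree ≤ n →
    0 < f.coeff 0 → 0 < f.eval 1 → 0 < f.eval (-1) →
    (∀ k, 1 ≤ k → k ≤ n - 1 → Even (n - 1 - k) → ∀ ε, 0 < specialDet (intCoeff f) n k ε) →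
    ∀ z : ℂ, ‖z‖ ≤ 1 → aeval z f ≠ 0 := by
  induction n with
  | zero => intro f hf h0 _ _ _ z _; exact aeval_ne_zero_of_natDegree_le_zero hf h0 z
  | succ n ih =>
    intro f hf h0 hp hm h z hz
    rw [Nat.add_sub_cancel] at h
    have hlt : |f.coeff (n + 1)| < f.coeff 0 := by
      rcases Nat.even_or_odd n with he | ⟨m, rfl⟩
      -- For formal degree `1` there is no determinant, but `f (±1) = a₀ ± a₁`.
      · rcases Nat.eq_zero_or_pos n with rfl | hn
        · rw [eval_eq_sum_range' (Nat.lt_succ_of_le hf)] at hp hm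
          simp [Finset.sum_range_succ] at hp hm
          exact abs_lt.mpr ⟨by linarith, by linarith⟩
        -- Here the formal degree `n + 1` is odd and at least `3`, so that `k = 2` is available.
        · obtain ⟨n, rfl⟩ : ∃ m, n = m + 1 := ⟨n - 1, by omega⟩
          refine abs_coeff_lt_of_specialDet_two_pos hf h0 (h 2 (by omega) ?_ ?_)
          · rcases he with ⟨m, hm⟩; omega
          · rcases he with ⟨m, hm⟩; exact ⟨m - 1, by omega⟩
      · exact specialDet_one_pos_iff.mp (h 1 le_rfl (by omega) ⟨m, by omega⟩)
    obtain ⟨hlt1, hlt2⟩ := abs_lt.mp hlt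
    refine aeval_ne_zero_of_schurTransform hf hlt
      (ih _ (natDegree_schurTransform_le hf) ?_ ?_ ?_ ?_) hz
    · rw [coeff_schurTransform_zero]
      exact (sq_sub_sq_pos_iff h0).mpr hlt
    · rw [schurTransform, eval_sub, eval_mul, eval_mul, eval_C, eval_C, eval_one_reflect hf,
        ← sub_mul]
      exact mul_pos (by linarith) hp
    · rw [schurTransform, eval_sub, eval_mul, eval_mul, eval_C, eval_C, eval_neg_one_reflect hf,
        ← mul_assoc, ← sub_mul]
      refine mul_pos ?_ hm
      rcases neg_one_pow_eq_or ℝ (n + 1) with e | e <;> rw [e] <;> linarith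
    · intro k h1 h2 he ε
      rw [specialDet_schurTransform_pos_iff hf hlt h1]
      exact h _ (by omega) (by omega) (by rwa [show n - (k + 1) = n - 1 - k by omega]) ε

/-- By the intermediate value theorem, since `f 0 > 0`. -/
theorem eval_pos_of_aeval_ne_zero {f : ℝ[X]} (h0 : 0 < f.coeff 0)
    (h : ∀ z : ℂ, ‖z‖ ≤ 1 → aeval z f ≠ 0) {x : ℝ} (hx : |x| ≤ 1) : 0 < f.eval x := by
  by_contra! hle
  have h00 : f.eval 0 = f.coeff 0 := (coeff_zero_eq_eval_zero f).symm
  obtain ⟨y, hy, hy0⟩ := intermediate_value_uIcc (a := x) (b := 0) f.continuous.continuousOn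
    (Set.mem_uIcc.mpr (Or.inl ⟨hle, by rw [h00]; exact h0.le⟩) : (0 : ℝ) ∈ _)
  refine h (y : ℂ) ?_ ?_
  · rw [Complex.norm_real, Real.norm_eq_abs]
    have := Set.abs_sub_le_of_uIcc_subset_uIcc (Set.uIcc_subset_uIcc hy Set.right_mem_uIcc)
    simp at this
    linarith
  · have := aeval_algebraMap_apply_eq_algebraMap_eval (A := ℂ) y f
    simpa [hy0] using this

/-! ### Reduction to the unit disc -/

theorem eval_DPoly (f : ℝ[X]) (k : ℕ) (ε : ℤˣ) (s : ℝ) :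
    (DPoly f k ε).eval s = specialDet (intCoeff (f.comp (C s * X))) f.natDegree k ε := by
  unfold DPoly specialDet
  rw [← coe_evalRingHom, RingHom.map_det]
  congr 1
  ext i j
  have h : ∀ m : ℤ, intCoeff f m * s ^ m.toNat = intCoeff (f.comp (C s * X)) m := by
    intro m
    unfold intCoeff
    split_ifs
    · rw [comp_C_mul_X_coeff]
    · ring
  simp only [RingHom.mapMatrix_apply, Matrix.map_apply, Matrix.of_apply, coe_evalRingHom,
    eval_add, eval_mul, eval_C, eval_pow, eval_X, eval_intCast, h]

theorem mainTheorem7 (f : Polynomial ℝ) (hn : 1 ≤ f.natDegree) (ha : 0 < f.coeff 0)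
    (s : ℝ) (hs : 0 < s) :
    ((∀ z : ℂ, z ∈ f.aroots ℂ → s < ‖z‖) ↔
      ∀ k : ℕ, 1 ≤ k → k ≤ f.natDegree → ∀ ε : ℤˣ, 0 < (DPoly f k ε).eval s) ∧
    ((∀ z : ℂ, z ∈ f.aroots ℂ → s < ‖z‖) ↔
      (0 < f.eval s ∧ 0 < f.eval (-s) ∧
        ∀ k : ℕ, 1 ≤ k → k ≤ f.natDegree - 1 → ∀ ε : ℤˣ, 0 < (DPoly f k ε).eval s)) ∧
    ((∀ z : ℂ, z ∈ f.aroots ℂ → s < ‖z‖) ↔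
      ∀ k : ℕ, 1 ≤ k → k ≤ f.natDegree → Even (f.natDegree - k) →
        ∀ ε : ℤˣ, 0 < (DPoly f k ε).eval s) ∧
    ((∀ z : ℂ, z ∈ f.aroots ℂ → s < ‖z‖) ↔
      (0 < f.eval s ∧ 0 < f.eval (-s) ∧
        ∀ k : ℕ, 1 ≤ k → k ≤ f.natDegree - 1 → Even (f.natDegree - 1 - k) →
          ∀ ε : ℤˣ, 0 < (DPoly f k ε).eval s)) := by
  have hf0 : f ≠ 0 := by rintro rfl; simp at ha
  obtain ⟨F, hF⟩ : ∃ F, F = f.comp (C s * X) := ⟨_, rfl⟩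
  have hFdeg : F.natDegree ≤ f.natDegree := by
    rw [hF, natDegree_comp, natDegree_C_mul_X _ hs.ne', mul_one]
  have hF0 : 0 < F.coeff 0 := by rw [hF, comp_C_mul_X_coeff]; simpa using ha
  have hF1 : F.eval 1 = f.eval s := by simp [hF]
  have hF2 : F.eval (-1) = f.eval (-s) := by simp [hF]
  have hFz : ∀ z : ℂ, aeval z F = aeval (s * z) f := by
    intro z
    simp [hF, aeval_comp]
  have hroots : (∀ z : ℂ, z ∈ f.aroots ℂ → s < ‖z‖) ↔ ∀ z : ℂ, ‖z‖ ≤ 1 → aeval z F ≠ 0 := by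
    constructor
    · intro h z hz h0
      have := h (s * z) (mem_aroots.mpr ⟨hf0, by rw [← hFz, h0]⟩)
      rw [norm_mul, Complex.norm_real, Real.norm_eq_abs, abs_of_pos hs] at this
      nlinarith
    · intro h z hz
      by_contra! hle
      have hs' : (s : ℂ) ≠ 0 := by exact_mod_cast hs.ne'
      refine h (z / s) ?_ ?_
      · rw [norm_div, Complex.norm_real, Real.norm_eq_abs, abs_of_pos hs]
        exact (div_le_one hs).mpr hle
      · rw [hFz, mul_div_cancel₀ _ hs']
        exact (mem_aroots.mp hz).2
  simp only [eval_DPoly, ← hF, hroots, ← hF1, ← hF2]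
  have hD := specialDet_pos_of_aeval_ne_zero _ F hFdeg hF0
  have hE : (∀ z : ℂ, ‖z‖ ≤ 1 → aeval z F ≠ 0) → 0 < F.eval 1 ∧ 0 < F.eval (-1) := fun h =>
    ⟨eval_pos_of_aeval_ne_zero hF0 h (by simp), eval_pos_of_aeval_ne_zero hF0 h (by simp)⟩
  have h3 := aeval_ne_zero_of_specialDet_pos _ F hFdeg hF0
  have h4 := aeval_ne_zero_of_eval_pos_of_specialDet_pos _ F hFdeg hF0
  refine ⟨⟨hD, fun h => h3 fun k h1 h2 _ => h k h1 h2⟩,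
    ⟨fun h => ⟨(hE h).1, (hE h).2, fun k h1 h2 => hD h k h1 (by omega)⟩,
      fun h => h4 h.1 h.2.1 fun k h1 h2 _ => h.2.2 k h1 h2⟩,
    ⟨fun h k h1 h2 _ => hD h k h1 h2, h3⟩,
    ⟨fun h => ⟨(hE h).1, (hE h).2, fun k h1 h2 _ => hD h k h1 (by omega)⟩,
      fun h => h4 h.1 h.2.1 h.2.2⟩⟩
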